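/- Let $(R,\mathfrak m)$ be a two-dimensional regular local ring whose residue field $R/\mathfrak m$ is uncountable (for example $R=\mathbb C[[x,y]]$). Let $\mathcal W_{\mathfrak m}$ be the valuative tree of $R$, i.e. the set of all valuations $\nu:R\to\mathbb R\cup\{\infty\}$ (with $\nu(\phi\psi)=\nu(\phi)+\nu(\psi)$, $\nu(\phi+\psi)\ge\min\{\nu(\phi),\nu(\psi)\}$, $\nu(1)=0$, $\nu(0)=\infty$) that are centered ($\nu\ge 0$ on $R$ and $\nu>0$ on $\mathfrak m$) and normalized by $\min\{\nu(\phi):\phi\in\mathfrak m\}=1$, partially ordered by $\nu\le\mu$ iff $\nu(\phi)\le\mu(\phi)$ for all $\phi\in R$. Let $\Psi:\mathcal W_{\mathfrak m}\to[1,\infty]$ be an (increasing) parametrization: a strictly increasing map whose restriction to every totally ordered convex subset is an isomorphism of ordered sets onto an interval of $[1,\infty]$. Then $\mathcal W_{\mathfrak m}$ is a rooted non-metric tree, i.e. it has a smallest element, every set $\{\sigma\mid\sigma\le\tau\}$ and every totally ordered convex subset is order-isomorphic to a real interval, and every non-empty subset has an infimum. Moreover, writing $\tau\wedge\sigma$ for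 the infimum of $\{\tau,\sigma\}$, with $1/\infty=0$, the function $$d_\Psi(\tau,\sigma)=\Big(\frac1{\Psi(\tau\wedge\sigma)}-\frac1{\Psi(\tau)}\Big)+\Big(\frac1{\Psi(\tau\wedge\sigma)}-\frac1{\Psi(\sigma)}\Big)$$ is a metric on $\mathcal W_{\mathfrak m}$, and the weak tree topology on $\mathcal W_{\mathfrak m}$ is strictly coarser than the topology of $d_\Psi$ (in particular the two topologies are different). Here the weak tree topology is the topology generated by the sets $$[\sigma]_\tau=\{\alpha\ne\tau\mid\ ]\tau,\sigma]\cap]\tau,\alpha]\ne\emptyset\},\qquad \sigma\neq\tau,$$ where $]\tau,\sigma]=[\tau,\sigma]\setminus\{\tau\}$ and $[\tau,\sigma]=\{\alpha\mid \tau\wedge\sigma\le\alpha\le\tau\ \text{or}\ \tau\wedge\sigma\le\alpha\le\sigma\}$. -/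

import Mathlib

namespace NonMetricTree

/-- A rooted non-metric tree: (T1) there is a smallest element; (T2) each `{σ | σ ≤ τ}` is
order-isomorphic to a real interval; (T3) so is each totally ordered convex subset; (T4) each
non-empty subset has an infimum. (Intervals may be degenerate or empty.) -/
structure IsRootedNonMetricTree (T : Type*) [PartialOrder T] : Prop where
  exists_root : ∃ τ₀ : T, IsBot τ₀
  iic_interval : ∀ τ : T, ∃ I : Set ℝ, I.OrdConnected ∧ Nonempty (Set.Iic τ ≃o I)
  chain_interval : ∀ S : Set T, IsChain (· ≤ ·) S → S.OrdConnected →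
    ∃ I : Set ℝ, I.OrdConnected ∧ Nonempty (S ≃o I)
  exists_inf : ∀ S : Set T, S.Nonempty → ∃ m : T, IsGLB S m

open Classical in
/-- `τ ∧ σ`, the infimum of `{τ, σ}` (which exists in a rooted non-metric tree; the value is
irrelevant when there is no infimum). -/
noncomputable def meet {T : Type*} [PartialOrder T] (τ σ : T) : T :=
  if h : ∃ m : T, IsGLB {τ, σ} m then h.choose else τ

theorem meet_eq {T : Type*} [PartialOrder T] {τ σ m : T} (h : IsGLB {τ, σ} m) :
    meet τ σ = m := by
  have h' : ∃ m : T, IsGLB {τ, σ} m := ⟨m, h⟩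
  rw [meet, dif_pos h']
  exact h'.choose_spec.unique h

/-- The closed segment `[τ, σ]`. -/
def closedSegment {T : Type*} [PartialOrder T] (τ σ : T) : Set T :=
  {α | (meet τ σ ≤ α ∧ α ≤ τ) ∨ (meet τ σ ≤ α ∧ α ≤ σ)}

/-- The half-open segment `]τ, σ]`. -/
def ocSegment {T : Type*} [PartialOrder T] (τ σ : T) : Set T :=
  closedSegment τ σ \ {τ}

/-- The relation `σ ∼_τ α`: the segments `]τ, σ]` and `]τ, α]` meet. -/
def TangentRel {T : Type*} [PartialOrder T] (τ σ α : T) : Prop :=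
  (ocSegment τ σ ∩ ocSegment τ α).Nonempty

/-- The tangent vector `[σ]_τ`, as a subset of `T \ {τ}`. -/
def tangentVector {T : Type*} [PartialOrder T] (τ σ : T) : Set T :=
  {α | α ≠ τ ∧ TangentRel τ σ α}

/-- The weak tree topology, generated by the tangent vectors at all points. -/
@[reducible]
def weakTreeTopology (T : Type*) [PartialOrder T] : TopologicalSpace T :=
  TopologicalSpace.generateFrom {U | ∃ τ σ : T, σ ≠ τ ∧ U = tangentVector τ σ}

/-- An increasing parametrization `Ψ : T → [-∞, ∞]`: an increasing map whose restriction to each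
totally ordered convex subset is an isomorphism of ordered sets onto an interval. -/
structure IsIncreasingParametrization {T : Type*} [PartialOrder T] (Ψ : T → EReal) : Prop where
  strictMono : StrictMono Ψ
  chain_iso : ∀ S : Set T, IsChain (· ≤ ·) S → S.OrdConnected →
    StrictMonoOn Ψ S ∧ (Ψ '' S).OrdConnected

/-- `d_Ψ(τ, σ) = (1/Ψ(τ ∧ σ) - 1/Ψ(τ)) + (1/Ψ(τ ∧ σ) - 1/Ψ(σ))` for `Ψ : T → [1, ∞]`,
with `1/∞ = 0`. -/
noncomputable def paramDist {T : Type*} [PartialOrder T] (Ψ : T → EReal) (τ σ : T) : ℝ :=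
  (((Ψ (meet τ σ))⁻¹).toReal - ((Ψ τ)⁻¹).toReal) +
    (((Ψ (meet τ σ))⁻¹).toReal - ((Ψ σ)⁻¹).toReal)

end NonMetricTree

/-- The valuative tree of a local ring `R` with maximal ideal `𝔪`: the set of centered valuations
`ν : R → ℝ ∪ {∞}` (written additively, possibly with non-zero support) normalized by
`ν(𝔪) = min {ν(φ) | φ ∈ 𝔪} = 1`. -/
@[ext]
structure ValuativeTree (R : Type*) [CommRing R] [IsLocalRing R] where
  val : AddValuation R (WithTop ℝ)
  nonneg : ∀ φ : R, 0 ≤ val φ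
  pos : ∀ φ ∈ IsLocalRing.maximalIdeal R, 0 < val φ
  normalized : IsLeast (val '' (IsLocalRing.maximalIdeal R : Set R)) 1

/-- `ν ≤ μ` if and only if `ν(φ) ≤ μ(φ)` for every `φ ∈ R`. -/
noncomputable instance ValuativeTree.instPartialOrder (R : Type*) [CommRing R] [IsLocalRing R] :
    PartialOrder (ValuativeTree R) :=
  PartialOrder.lift (fun ν : ValuativeTree R => (fun φ : R => ν.val φ))
    (fun _ _ h => ValuativeTree.ext (DFunLike.coe_injective h))

/-!
The valuative tree of a two-dimensional regular local ring, and its two topologies.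

The heart of the matter is that two valuations `ν₁, ν₂` below a third one `μ` are comparable
(`ValuativeTree.le_or_le_of_le`). Choose `x` with `μ(x) = 1`; it belongs to a regular system of
parameters `x, z`, and all three valuations take the value `1` at `x`. The order of vanishing modulo
`x` of an element from which all factors `x` have been removed is then a Euclidean function, up to
powers of `x` (`IsLocalRing.exists_eq_mul_add_pow_mul`; it is the degree in Weierstrass division,
but the argument needs no completeness, Krull's intersection theorem suffices). If `Φ` is an element
of least order at which `ν₁` or `ν₂` is smaller than `μ`, and `ν₁(Φ) ≤ ν₂(Φ)`, then `Φ` is a key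
polynomial for `ν₁`: in `f = q Φ + r` there is no cancellation for `ν₁`, as it would be visible to
`μ`. Expanding `f` in powers of `Φ` gives `ν₁(f) ≤ ν₂(f)` (`ValuativeTree.le_of_val_le`).

The root, the multiplicity valuation, is the generic value along a pencil of curves `y - t x`: for
each residue class of `t` there is a curve valuation with the value `1` at `x` and `∞` at `y - t x`,
and all but finitely many of them agree at a given element
(`ValuativeTree.exists_eventually_val_eq`). As the lower bounds of a set form a chain, their
pointwise supremum is a valuation, so infima exist. The parametrization itself identifies chains
with real intervals.

The metric axioms and the openness of tangent vectors for the metric are order theory. The two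
topologies differ at the root. A weak neighbourhood of the root contains all points that lie above
none of finitely many points other than the root, and each of these finitely many points lies below
at most one of the curve valuations of the pencil. There are uncountably many of the latter, so
infinitely many of them avoid some fixed ball around the root.
-/

open IsLocalRing Filter
open scoped Topology

/-! ### Order theory of trees -/

namespace NonMetricTree

/-- The two order-theoretic properties of a non-metric tree that the study of segments, tangent
vectors and parametrized distances uses: the elements below a given one form a chain, and any two
elements have an infimum. -/
structure IsMeetTree (T : Type*) [PartialOrder T] : Prop where
  comparable : ∀ {τ a b : T}, a ≤ τ → b ≤ τ → a ≤ b ∨ b ≤ a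
  exists_meet : ∀ a b : T, ∃ m : T, IsGLB {a, b} m

namespace IsMeetTree

variable {T : Type*} [PartialOrder T] (hT : IsMeetTree T)

include hT

theorem isGLB_meet (a b : T) : IsGLB {a, b} (meet a b) := by
  obtain ⟨m, hm⟩ := hT.exists_meet a b
  rwa [meet_eq hm]

theorem meet_le_left (a b : T) : meet a b ≤ a := (hT.isGLB_meet a b).1 (by simp)

theorem meet_le_right (a b : T) : meet a b ≤ b := (hT.isGLB_meet a b).1 (by simp)

theorem le_meet {a b c : T} (ha : c ≤ a) (hb : c ≤ b) : c ≤ meet a b :=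
  (hT.isGLB_meet a b).2 (by simp [ha, hb])

theorem meet_comm (a b : T) : meet a b = meet b a :=
  le_antisymm (hT.le_meet (hT.meet_le_right a b) (hT.meet_le_left a b))
    (hT.le_meet (hT.meet_le_right b a) (hT.meet_le_left b a))

theorem meet_self (a : T) : meet a a = a :=
  le_antisymm (hT.meet_le_left a a) (hT.le_meet le_rfl le_rfl)

theorem meet_lt_left {a b : T} (h : ¬ a ≤ b) : meet a b < a :=
  lt_of_le_of_ne (hT.meet_le_left a b) fun e => h (e ▸ hT.meet_le_right a b)

/-- Two points define the same tangent vector at `τ` in one of two ways: both lie in the downward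
direction, or both lie above a common point strictly above `τ`. -/
theorem tangentRel_iff (τ σ α : T) :
    TangentRel τ σ α ↔ (¬ τ ≤ σ ∧ ¬ τ ≤ α) ∨ ∃ γ, τ < γ ∧ γ ≤ σ ∧ γ ≤ α := by
  constructor
  · rintro ⟨γ, ⟨h1, hne⟩, ⟨h2, -⟩⟩
    have hne : γ ≠ τ := hne
    by_cases hγ : γ ≤ τ
    · have hlt : ¬ τ ≤ γ := fun h => hne (le_antisymm hγ h)
      refine Or.inl ⟨fun h => hlt ?_, fun h => hlt ?_⟩
      · exact (hT.le_meet le_rfl h).trans (h1.elim And.left And.left)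
      · exact (hT.le_meet le_rfl h).trans (h2.elim And.left And.left)
    · have hσ : γ ≤ σ := h1.elim (fun h => absurd h.2 hγ) And.right
      have hα : γ ≤ α := h2.elim (fun h => absurd h.2 hγ) And.right
      by_cases hs : τ ≤ σ
      · exact Or.inr ⟨γ, lt_of_le_of_ne
          ((hT.le_meet le_rfl hs).trans (h1.elim And.left And.left)) hne.symm, hσ, hα⟩
      by_cases ha : τ ≤ α
      · exact Or.inr ⟨γ, lt_of_le_of_ne
          ((hT.le_meet le_rfl ha).trans (h2.elim And.left And.left)) hne.symm, hσ, hα⟩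
      exact Or.inl ⟨hs, ha⟩
  · rintro (⟨hs, ha⟩ | ⟨γ, hγ, hs, ha⟩)
    · -- The larger of `τ ∧ σ` and `τ ∧ α` lies in both segments.
      rcases hT.comparable (hT.meet_le_left τ σ) (hT.meet_le_left τ α) with h | h
      · exact ⟨meet τ α, ⟨Or.inl ⟨h, hT.meet_le_left τ α⟩, (hT.meet_lt_left ha).ne⟩,
          ⟨Or.inl ⟨le_rfl, hT.meet_le_left τ α⟩, (hT.meet_lt_left ha).ne⟩⟩
      · exact ⟨meet τ σ, ⟨Or.inl ⟨le_rfl, hT.meet_le_left τ σ⟩, (hT.meet_lt_left hs).ne⟩,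
          ⟨Or.inl ⟨h, hT.meet_le_left τ σ⟩, (hT.meet_lt_left hs).ne⟩⟩
    · exact ⟨γ, ⟨Or.inr ⟨(hT.meet_le_left _ _).trans hγ.le, hs⟩, hγ.ne'⟩,
        ⟨Or.inr ⟨(hT.meet_le_left _ _).trans hγ.le, ha⟩, hγ.ne'⟩⟩

end IsMeetTree

/-! ### The metric of a strictly decreasing function, and the weak topology -/

/-- The distance along the tree measured by a decreasing function `f`: the length of the descent
from `τ` to `τ ∧ σ` plus that of the descent from `σ` to `τ ∧ σ`. -/
noncomputable def treeDist {T : Type*} [PartialOrder T] (f : T → ℝ) (τ σ : T) : ℝ :=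
  (f (meet τ σ) - f τ) + (f (meet τ σ) - f σ)

section Metric

variable {T : Type*} [PartialOrder T] {f : T → ℝ} (hT : IsMeetTree T) (hf : StrictAnti f)

include hT hf

theorem treeDist_triangle (a b c : T) :
    treeDist f a c ≤ treeDist f a b + treeDist f b c := by
  have h1 := hf.antitone (hT.meet_le_right a b)
  have h2 := hf.antitone (hT.meet_le_left b c)
  unfold treeDist
  rcases hT.comparable (hT.meet_le_right a b) (hT.meet_le_left b c) with h | h
  · have := hf.antitone (hT.le_meet (hT.meet_le_left a b) (h.trans (hT.meet_le_right b c)))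
    linarith
  · have := hf.antitone (hT.le_meet (h.trans (hT.meet_le_left a b)) (hT.meet_le_right b c))
    linarith

theorem eq_of_treeDist_eq_zero {a b : T} (h : treeDist f a b = 0) : a = b := by
  have h1 := hf.antitone (hT.meet_le_left a b)
  have h2 := hf.antitone (hT.meet_le_right a b)
  unfold treeDist at h
  have key : ∀ c, meet a b ≤ c → f (meet a b) ≤ f c → meet a b = c := fun c hc hfc =>
    hc.eq_of_not_lt fun hlt => (hf hlt).not_ge hfc
  rw [← key a (hT.meet_le_left a b) (by linarith)]
  exact key b (hT.meet_le_right a b) (by linarith)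

/-- The metric on a tree defined by a strictly decreasing function. -/
@[reducible]
noncomputable def treeMetric : MetricSpace T where
  dist := treeDist f
  dist_self a := by simp [treeDist, hT.meet_self]
  dist_comm a b := by simp only [treeDist, hT.meet_comm a b]; ring
  dist_triangle := treeDist_triangle hT hf
  eq_of_dist_eq_zero := eq_of_treeDist_eq_zero hT hf

/-- A point that is not above `τ` is at least as far from every point above `τ` as from `τ`. -/
theorem treeDist_le_of_not_le {τ α β : T} (hα : ¬ τ ≤ α) (hβ : τ ≤ β) :
    treeDist f α τ ≤ treeDist f α β := by
  have hle : meet α β ≤ τ := by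
    rcases hT.comparable (hT.meet_le_right α β) hβ with h | h
    · exact h
    · exact absurd (h.trans (hT.meet_le_left α β)) hα
  have h1 := hf.antitone (hT.le_meet (hT.meet_le_left α β) hle)
  have h2 := hf.antitone hβ
  unfold treeDist
  linarith

/-- The path from a point `α` above `τ` to a point `β` passes through `τ` unless it stays
strictly above `τ`. -/
theorem treeDist_le_of_not_lt_meet {τ α β : T} (hα : τ ≤ α) (h : ¬ τ < meet α β) :
    treeDist f α τ ≤ treeDist f α β := by
  have hle : meet α β ≤ τ := by
    rcases hT.comparable (hT.meet_le_left α β) hα with h' | h'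
    · exact h'
    · exact (h'.eq_of_not_lt h).ge
  have h1 := hf.antitone hle
  have h2 := hf.antitone (hT.meet_le_right α β)
  have h3 : meet α τ = τ := le_antisymm (hT.meet_le_right _ _) (hT.le_meet hα le_rfl)
  unfold treeDist
  rw [h3]
  linarith

/-- Tangent vectors are open for the metric: the ball around `α` reaching up to `τ` stays in the
tangent vector of `α` at `τ`. -/
theorem isOpen_tangentVector (τ σ : T) :
    IsOpen[(treeMetric hT hf).toUniformSpace.toTopologicalSpace] (tangentVector τ σ) := by
  let _ := treeMetric hT hf
  refine Metric.isOpen_iff.2 ?_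
  rintro α ⟨hne, hα⟩
  refine ⟨dist α τ, dist_pos.2 hne, fun β hβ => ?_⟩
  have hβ' : treeDist f α β < treeDist f α τ := by
    rw [Metric.mem_ball, dist_comm] at hβ
    exact hβ
  refine ⟨?_, (hT.tangentRel_iff τ σ β).2 ?_⟩
  · rintro rfl
    exact lt_irrefl _ hβ'
  · rcases (hT.tangentRel_iff τ σ α).1 hα with ⟨hs, ha⟩ | ⟨γ, hγ, hs, ha⟩
    · exact Or.inl ⟨hs, fun hb => (treeDist_le_of_not_le hT hf ha hb).not_gt hβ'⟩
    · have hlt : τ < meet α β := by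
        by_contra hlt
        exact (treeDist_le_of_not_lt_meet hT hf (hγ.le.trans ha) hlt).not_gt hβ'
      rcases hT.comparable ha (hT.meet_le_left α β) with h | h
      · exact Or.inr ⟨γ, hγ, hs, h.trans (hT.meet_le_right α β)⟩
      · exact Or.inr ⟨meet α β, hlt, h.trans hs, hT.meet_le_right α β⟩

theorem treeMetric_le_weakTreeTopology :
    (treeMetric hT hf).toUniformSpace.toTopologicalSpace ≤ weakTreeTopology T := by
  refine le_generateFrom ?_
  rintro _ ⟨τ, σ, -, rfl⟩
  exact isOpen_tangentVector hT hf τ σ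

end Metric

/-- Every weak neighbourhood of the root contains all the points that are above none of finitely
many points different from the root. -/
theorem exists_finite_of_mem_weak_nhds_bot {T : Type*} [PartialOrder T] (hT : IsMeetTree T)
    {r : T} (hr : IsBot r) {U : Set T} (hU : IsOpen[weakTreeTopology T] U) (hrU : r ∈ U) :
    ∃ F : Set T, F.Finite ∧ r ∉ F ∧ ∀ α, (∀ τ ∈ F, ¬ τ ≤ α) → α ∈ U := by
  induction hU with
  | basic s hs =>
    obtain ⟨τ, σ, -, rfl⟩ := hs
    refine ⟨{τ}, Set.finite_singleton τ, fun h => hrU.1 h, fun α hα => ?_⟩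
    have hα : ¬ τ ≤ α := hα τ rfl
    refine ⟨fun h => hα h.ge, (hT.tangentRel_iff τ σ α).2 ?_⟩
    rcases (hT.tangentRel_iff τ σ r).1 hrU.2 with ⟨hs, -⟩ | ⟨γ, hγ, -, hγr⟩
    · exact Or.inl ⟨hs, hα⟩
    · exact absurd (hγ.trans_le hγr) (hr τ).not_gt
  | univ => exact ⟨∅, Set.finite_empty, by simp, fun _ _ => trivial⟩
  | inter s t _ _ ihs iht =>
    obtain ⟨F, hF, hrF, h⟩ := ihs hrU.1
    obtain ⟨G, hG, hrG, h'⟩ := iht hrU.2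
    exact ⟨F ∪ G, hF.union hG, by simp [hrF, hrG], fun α hα =>
      ⟨h α fun τ hτ => hα τ (Or.inl hτ), h' α fun τ hτ => hα τ (Or.inr hτ)⟩⟩
  | sUnion S _ ih =>
    obtain ⟨s, hsS, hrs⟩ := hrU
    obtain ⟨F, hF, hrF, h⟩ := ih s hsS hrs
    exact ⟨F, hF, hrF, fun α hα => ⟨s, hsS, h α hα⟩⟩

/-- If uncountably many points branch off at the root in pairwise different directions, then
infinitely many of them stay outside a fixed ball around the root, while every weak neighbourhood
of the root contains all but finitely many of them. -/
theorem treeMetric_lt_weakTreeTopology {T : Type*} [PartialOrder T] {f : T → ℝ}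
    (hT : IsMeetTree T) (hf : StrictAnti f) {r : T} (hr : IsBot r) {ι : Type*} [Uncountable ι]
    (g : ι → T) (hg : ∀ i, g i ≠ r) (hbranch : ∀ i j τ, τ ≤ g i → τ ≤ g j → i ≠ j → τ = r) :
    (treeMetric hT hf).toUniformSpace.toTopologicalSpace < weakTreeTopology T := by
  refine lt_of_le_not_ge (treeMetric_le_weakTreeTopology hT hf) fun hle => ?_
  let _ := treeMetric hT hf
  obtain ⟨n, hn⟩ : ∃ n : ℕ, {i | 1 / ((n : ℝ) + 1) < dist (g i) r}.Infinite := by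
    by_contra! hfin
    refine not_countable (α := ι) (Set.countable_univ_iff.1 ?_)
    refine (Set.countable_iUnion fun n => (hfin n).countable).mono fun i _ => ?_
    obtain ⟨n, hn⟩ := exists_nat_one_div_lt (dist_pos.2 (hg i))
    exact Set.mem_iUnion.2 ⟨n, hn⟩
  obtain ⟨F, hF, hrF, h⟩ := exists_finite_of_mem_weak_nhds_bot hT hr
    (hle _ (Metric.isOpen_ball (x := r) (ε := 1 / ((n : ℝ) + 1))))
    (Metric.mem_ball_self Nat.one_div_pos_of_nat)
  refine hn ((hF.biUnion (t := fun τ => {i | τ ≤ g i}) fun τ hτ => ?_).subset fun i hi => ?_)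
  · refine Set.Subsingleton.finite fun i hi j hj => ?_
    by_contra hij
    exact hrF (hbranch i j τ hi hj hij ▸ hτ)
  · by_contra hi'
    have hmem := h (g i) fun τ hτ hle => hi' (Set.mem_biUnion hτ hle)
    exact lt_asymm hi (Metric.mem_ball.1 hmem)

/-! ### Parametrizations with values in `[1, ∞]` -/

theorem ereal_inv_toReal_strictAntiOn :
    StrictAntiOn (fun e : EReal => (e⁻¹).toReal) (Set.Ici 1) := by
  intro a ha b hb hab
  have ha : (1 : EReal) ≤ a := ha
  have hpos : (0 : EReal) < a := zero_lt_one.trans_le ha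
  lift a to ℝ using ⟨hab.ne_top, (EReal.bot_lt_zero.trans hpos).ne'⟩
  have ha' : 0 < a := by exact_mod_cast hpos
  induction b with
  | bot => simp at hab
  | top => simpa [← EReal.coe_inv] using ha'
  | coe b =>
    have hab' : a < b := by exact_mod_cast hab
    simpa [← EReal.coe_inv] using (inv_lt_inv₀ (ha'.trans hab') ha').2 hab'

/-- An interval of `[1, ∞]` is carried by `e ↦ -1/e` to an interval of `ℝ`. -/
theorem ordConnected_image_neg_inv {A : Set EReal} (hA : A.OrdConnected)
    (hA1 : A ⊆ Set.Ici 1) : ((fun e : EReal => -(e⁻¹).toReal) '' A).OrdConnected := by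
  refine ⟨?_⟩
  rintro _ ⟨a, ha, rfl⟩ _ ⟨b, hb, rfl⟩ u ⟨hu1, hu2⟩
  have hsurj : ∃ e : EReal, 1 ≤ e ∧ (e⁻¹).toReal = -u := by
    have h1 : (a⁻¹).toReal ≤ 1 := by
      have := ereal_inv_toReal_strictAntiOn.antitoneOn (Set.self_mem_Ici (a := (1 : EReal)))
        (hA1 ha) (hA1 ha)
      simpa using this
    have h0 : 0 ≤ (b⁻¹).toReal := by
      have := ereal_inv_toReal_strictAntiOn.antitoneOn (hA1 hb) (Set.mem_Ici.2 le_top) le_top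
      simpa using this
    simp only at hu1 hu2
    rcases (show 0 ≤ -u by linarith).eq_or_lt with h | h
    · exact ⟨⊤, le_top, by simpa using h⟩
    · refine ⟨(((-u)⁻¹ : ℝ) : EReal), ?_, by rw [← EReal.coe_inv, inv_inv, EReal.toReal_coe]⟩
      have : 1 ≤ (-u)⁻¹ := (one_le_inv₀ h).2 (by linarith)
      exact_mod_cast this
  obtain ⟨e, he1, he⟩ := hsurj
  refine ⟨e, hA.out ha hb ⟨?_, ?_⟩, by simp [he]⟩
  · refine (ereal_inv_toReal_strictAntiOn.le_iff_ge (Set.mem_Ici.2 he1) (hA1 ha)).1 ?_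
    simp only at hu1 ⊢
    linarith
  · refine (ereal_inv_toReal_strictAntiOn.le_iff_ge (hA1 hb) (Set.mem_Ici.2 he1)).1 ?_
    simp only at hu2 ⊢
    linarith

theorem strictAnti_inv_parametrization {T : Type*} [PartialOrder T] {Ψ : T → EReal}
    (hΨ : IsIncreasingParametrization Ψ) (hΨ1 : ∀ τ, 1 ≤ Ψ τ) :
    StrictAnti fun τ => ((Ψ τ)⁻¹).toReal := fun _ _ h =>
  ereal_inv_toReal_strictAntiOn (hΨ1 _) (hΨ1 _) (hΨ.strictMono h)

/-- The parametrization itself identifies a totally ordered convex subset with a real interval. -/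
theorem exists_interval_of_parametrization {T : Type*} [PartialOrder T] {Ψ : T → EReal}
    (hΨ : IsIncreasingParametrization Ψ) (hΨ1 : ∀ τ, 1 ≤ Ψ τ) (S : Set T)
    (hS : IsChain (· ≤ ·) S) (hconv : S.OrdConnected) :
    ∃ I : Set ℝ, I.OrdConnected ∧ Nonempty (S ≃o I) := by
  have hanti := strictAnti_inv_parametrization hΨ hΨ1
  refine ⟨(fun e : EReal => -(e⁻¹).toReal) '' (Ψ '' S), ordConnected_image_neg_inv
    (hΨ.chain_iso S hS hconv).2 (by rintro _ ⟨τ, -, rfl⟩; exact hΨ1 τ), ?_⟩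
  rw [Set.image_image]
  let g : S → (fun τ => -((Ψ τ)⁻¹).toReal) '' S := fun τ => ⟨_, τ, τ.2, rfl⟩
  have hg : StrictMono g := fun a b h => neg_lt_neg (hanti h)
  have hle : ∀ a b, g a ≤ g b ↔ a ≤ b := fun a b => by
    refine ⟨fun h => ?_, fun h => hg.monotone h⟩
    rcases hS.total a.2 b.2 with h' | h'
    · exact h'
    · exact (h'.eq_of_not_lt fun hlt => (hg hlt).not_ge h).ge
  refine ⟨⟨Equiv.ofBijective g ⟨fun a b h => ?_, ?_⟩, fun {a b} => hle a b⟩⟩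
  · exact le_antisymm ((hle a b).1 h.le) ((hle b a).1 h.ge)
  · rintro ⟨_, τ, hτ, rfl⟩
    exact ⟨⟨τ, hτ⟩, rfl⟩

end NonMetricTree

/-! ### Krull intersections -/

theorem Ideal.mem_of_forall_mem_sup_pow {R : Type*} [CommRing R] [IsNoetherianRing R]
    [IsLocalRing R] {I J : Ideal R} (hI : I ≠ ⊤) {f : R} (h : ∀ n : ℕ, f ∈ J ⊔ I ^ n) : f ∈ J := by
  have hbot := Ideal.iInf_pow_smul_eq_bot_of_isLocalRing (R := R) (M := R ⧸ J) I hI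
  have hf : (Ideal.Quotient.mk J f : R ⧸ J) ∈
      (⨅ i : ℕ, I ^ i • ⊤ : Submodule R (R ⧸ J)) := by
    refine (Submodule.mem_iInf _).2 fun n => ?_
    obtain ⟨a, ha, b, hb, rfl⟩ := Submodule.mem_sup.1 (h n)
    rw [map_add, Ideal.Quotient.eq_zero_iff_mem.2 ha, zero_add]
    have : Ideal.Quotient.mk J b = b • (1 : R ⧸ J) := by
      rw [Algebra.smul_def, mul_one]; rfl
    rw [this]
    exact Submodule.smul_mem_smul hb trivial
  rw [hbot, Submodule.mem_bot] at hf
  exact Ideal.Quotient.eq_zero_iff_mem.1 hf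

/-! ### Elementary properties of centered valuations -/

namespace ValuativeTree

section Basic

variable {R : Type*} [CommRing R] [IsLocalRing R] (ν : ValuativeTree R)

theorem one_le_val {φ : R} (h : φ ∈ maximalIdeal R) : 1 ≤ ν.val φ :=
  ν.normalized.2 ⟨φ, h, rfl⟩

theorem val_of_isUnit {u : R} (h : IsUnit u) : ν.val u = 0 := by
  obtain ⟨v, hv⟩ := h.exists_right_inv
  have h1 := ν.val.map_mul u v
  rw [hv, ν.val.map_one] at h1
  refine le_antisymm ?_ (ν.nonneg u)
  rw [h1]
  exact le_add_of_nonneg_right (ν.nonneg v)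

theorem natCast_le_val {n : ℕ} {φ : R} (h : φ ∈ maximalIdeal R ^ n) :
    (n : WithTop ℝ) ≤ ν.val φ := by
  induction n generalizing φ with
  | zero => simpa using ν.nonneg φ
  | succ n ih =>
    rw [pow_succ] at h
    refine Submodule.mul_induction_on h (fun a ha b hb => ?_) fun a b ha hb =>
      ν.val.map_le_add ha hb
    rw [ν.val.map_mul, Nat.cast_succ]
    exact add_le_add (ih ha) (ν.one_le_val hb)

theorem notMem_sq {x : R} (h : ν.val x = 1) : x ∉ maximalIdeal R ^ 2 := fun hx => by
  have h2 := ν.natCast_le_val hx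
  rw [h] at h2
  norm_num at h2

theorem val_congr {a b : R} (h : ν.val (a - b) = ⊤) : ν.val a = ν.val b := by
  apply le_antisymm
  · have := ν.val.map_sub a (a - b)
    rwa [h, min_top_right, sub_sub_cancel] at this
  · have := ν.val.map_add (a - b) b
    rwa [h, min_top_left, sub_add_cancel] at this

/-- A valuation lying below another one takes the value `1` wherever the larger one does. -/
theorem val_eq_one_of_le {ν μ : ValuativeTree R} (h : ν ≤ μ) {x : R} (hx : x ∈ maximalIdeal R)
    (hμ : μ.val x = 1) : ν.val x = 1 :=
  le_antisymm (hμ ▸ h x) (ν.one_le_val hx)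

end Basic

end ValuativeTree

/-! ### Regular parameters and Euclidean division -/

theorem IsLocalRing.exists_maximalIdeal_eq_span_pair {R : Type*} [CommRing R]
    [IsRegularLocalRing R] (hdim : ringKrullDim R = 2) :
    ∃ x y : R, maximalIdeal R = Ideal.span {x, y} := by
  have h2 : (maximalIdeal R).spanFinrank = 2 := by
    have := IsRegularLocalRing.spanFinrank_maximalIdeal (R := R)
    rw [hdim] at this
    exact_mod_cast this
  rw [← Submodule.FG.generators_ncard (maximalIdeal R).fg_of_isNoetherianRing,
    Set.ncard_eq_two] at h2
  obtain ⟨x, y, -, h⟩ := h2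
  exact ⟨x, y, by rw [← h]; exact ((maximalIdeal R).span_generators).symm⟩

theorem IsLocalRing.exists_maximalIdeal_eq_span_pair_of_notMem_sq {R : Type*} [CommRing R]
    [IsRegularLocalRing R] (hdim : ringKrullDim R = 2) {x : R} (hx : x ∈ maximalIdeal R)
    (hx2 : x ∉ maximalIdeal R ^ 2) : ∃ z : R, maximalIdeal R = Ideal.span {x, z} := by
  obtain ⟨a, b, hab⟩ := IsLocalRing.exists_maximalIdeal_eq_span_pair hdim
  have ha : a ∈ maximalIdeal R := hab ▸ Ideal.subset_span (by simp)
  have hb : b ∈ maximalIdeal R := hab ▸ Ideal.subset_span (by simp)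
  obtain ⟨u, v, huv⟩ := Ideal.mem_span_pair.1 (hab ▸ hx)
  -- One of the coefficients of `x` is a unit, so `x` can replace one of the generators.
  have key : ∀ a b u v : R, maximalIdeal R = Ideal.span {a, b} → u * a + v * b = x →
      IsUnit u → maximalIdeal R = Ideal.span {x, b} := by
    intro a b u v hab huv hu
    obtain ⟨w, hw⟩ := hu.exists_right_inv
    apply le_antisymm
    · rw [hab, Ideal.span_le]
      rintro c (rfl | rfl)
      · refine Ideal.mem_span_pair.2 ⟨w, -(w * v), ?_⟩
        rw [← huv]
        linear_combination c * hw
      · exact Ideal.subset_span (by simp)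
    · rw [Ideal.span_le]
      rintro c (rfl | rfl)
      · exact hx
      · exact hab ▸ Ideal.subset_span (by simp)
  by_cases hu : IsUnit u
  · exact ⟨b, key a b u v hab huv hu⟩
  by_cases hv : IsUnit v
  · exact ⟨a, key b a v u (by rw [hab, Set.pair_comm]) (by rw [← huv, add_comm]) hv⟩
  refine absurd ?_ hx2
  rw [← huv, pow_two]
  exact Ideal.add_mem _ (Ideal.mul_mem_mul hu ha) (Ideal.mul_mem_mul hv hb)

/-- Euclidean division. Here `d` is the order of vanishing of `Φ` modulo `x`, and the remainder,
up to a power of `x`, vanishes to a smaller order modulo `x`. -/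
theorem IsLocalRing.exists_eq_mul_add_pow_mul {R : Type*} [CommRing R] [IsNoetherianRing R]
    [IsLocalRing R] {x z Φ : R} {d : ℕ} (hm : maximalIdeal R = Ideal.span {x, z})
    (hΦ : Φ ∈ Ideal.span {x, z ^ d}) (hΦ' : Φ ∉ Ideal.span {x, z ^ (d + 1)}) (f : R) :
    ∃ q r : R, f = q * Φ + r ∧
      (r = 0 ∨ ∃ (s : ℕ) (r' : R), r = x ^ s * r' ∧ r' ∉ Ideal.span {x, z ^ d}) := by
  have hx : x ∈ maximalIdeal R := hm ▸ Ideal.subset_span (by simp)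
  obtain ⟨a, u, hau⟩ := Ideal.mem_span_pair.1 hΦ
  have hu : IsUnit u := by
    by_contra hu
    obtain ⟨b, c, hbc⟩ := Ideal.mem_span_pair.1 (hm ▸ (mem_maximalIdeal u).2 hu)
    refine hΦ' (Ideal.mem_span_pair.2 ⟨a + b * z ^ d, c, ?_⟩)
    rw [← hau, ← hbc]
    ring
  obtain ⟨w, hw⟩ := hu.exists_left_inv
  by_contra! hcon
  have hstep : ∀ n : ℕ, ∃ q g : R, f = q * Φ + x ^ n * g := by
    intro n
    induction n with
    | zero => exact ⟨0, f, by simp⟩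
    | succ n ih =>
      obtain ⟨q, g, hqg⟩ := ih
      have hg : g ∈ Ideal.span {x, z ^ d} := by
        by_contra hg
        exact hg ((hcon q _ hqg).2 n g rfl)
      obtain ⟨b, c, hbc⟩ := Ideal.mem_span_pair.1 hg
      refine ⟨q + x ^ n * c * w, b - c * w * a, ?_⟩
      rw [hqg, ← hbc, ← hau]
      linear_combination (-x ^ n * c * z ^ d) * hw
  have hmem : f ∈ Ideal.span {Φ} := by
    refine Ideal.mem_of_forall_mem_sup_pow (I := Ideal.span {x}) ?_ fun n => ?_
    · exact ne_top_of_le_ne_top (maximalIdeal.isMaximal R).ne_top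
        ((Ideal.span_singleton_le_iff_mem _).2 hx)
    · obtain ⟨q, g, hqg⟩ := hstep n
      rw [hqg, Ideal.span_singleton_pow]
      exact Submodule.add_mem_sup (Ideal.mul_mem_left _ _ (Ideal.mem_span_singleton_self _))
        (Ideal.mul_mem_right _ _ (Ideal.mem_span_singleton_self _))
  obtain ⟨q, hq⟩ := Ideal.mem_span_singleton'.1 hmem
  exact (hcon q 0 (by rw [add_zero, hq])).1 rfl

/-! ### Comparability of valuations below a common one -/

namespace ValuativeTree

section Comparison

variable {R : Type*} [CommRing R] [IsNoetherianRing R] [IsLocalRing R]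

/-- Let `ν₁, ν₂` be valuations that agree with `μ` on the elements whose order of vanishing modulo
`x` is less than that of `Φ`, where `ν₁ ≤ μ` and `ν₁(Φ) < μ(Φ)`. Then the value of `ν₁` on a
`Φ`-adic expansion is the minimum of the values of its terms, so `ν₁(Φ) ≤ ν₂(Φ)` implies
`ν₁ ≤ ν₂`. -/
theorem le_of_val_le {x z Φ : R} {d : ℕ} (hm : maximalIdeal R = Ideal.span {x, z})
    (hΦm : Φ ∈ maximalIdeal R) (hΦ : Φ ∈ Ideal.span {x, z ^ d})
    (hΦ' : Φ ∉ Ideal.span {x, z ^ (d + 1)}) {μ ν₁ ν₂ : ValuativeTree R} (h1 : ν₁ ≤ μ)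
    (hx1 : ν₁.val x = μ.val x) (hx2 : ν₂.val x = μ.val x)
    (hagree : ∀ r ∉ Ideal.span {x, z ^ d}, ν₁.val r = μ.val r ∧ ν₂.val r = μ.val r)
    (hlt : ν₁.val Φ < μ.val Φ) (hle : ν₁.val Φ ≤ ν₂.val Φ) : ν₁ ≤ ν₂ := by
  have hdiv : ∀ f : R, ∃ q r : R, f = q * Φ + r ∧ ν₁.val r = μ.val r ∧ ν₂.val r = μ.val r := by
    intro f
    obtain ⟨q, r, hf, hr⟩ := IsLocalRing.exists_eq_mul_add_pow_mul hm hΦ hΦ' f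
    refine ⟨q, r, hf, ?_⟩
    rcases hr with rfl | ⟨s, r', rfl, hr'⟩
    · simp only [AddValuation.map_zero, and_self]
    · simp only [AddValuation.map_mul, AddValuation.map_pow, hx1, hx2, (hagree r' hr').1,
        (hagree r' hr').2, and_self]
  -- No cancellation occurs in `q Φ + r` for `ν₁`: it would be inherited by `μ`, for which the
  -- value of `q Φ` is larger than that of `r`.
  have hkey : ∀ f q r : R, f = q * Φ + r → ν₁.val r = μ.val r →
      ν₁.val f ≤ ν₁.val r ∧ ν₁.val f ≤ ν₁.val (q * Φ) := by
    intro f q r hf hr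
    have hfr : ν₁.val f ≤ ν₁.val r := by
      by_contra! hcon
      have hq : q * Φ = f - r := by rw [hf]; ring
      have h2 : ν₁.val (q * Φ) = ν₁.val r := by
        rw [hq, ν₁.val.map_sub_eq_of_lt_right hcon]
      rw [ν₁.val.map_mul] at h2
      have hqtop : ν₁.val q ≠ ⊤ := by
        intro htop
        rw [htop, top_add] at h2
        exact hcon.ne_top h2.symm
      have h3 : μ.val r < μ.val (q * Φ) := by
        rw [μ.val.map_mul, ← hr, ← h2]
        exact (WithTop.add_lt_add_left hqtop hlt).trans_le (by gcongr; exact h1 q)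
      have h4 : μ.val r < μ.val f := (hr ▸ hcon).trans_le (h1 f)
      have h5 := μ.val.map_lt_add h4 (y := -(q * Φ)) (by rwa [μ.val.map_neg])
      rw [← sub_eq_add_neg, hf, add_sub_cancel_left] at h5
      exact lt_irrefl _ h5
    refine ⟨hfr, ?_⟩
    have : q * Φ = f - r := by rw [hf]; ring
    rw [this]
    exact ν₁.val.map_le_sub le_rfl hfr
  have hN : ∀ (N : ℕ) (f : R), min (ν₁.val f) (N : WithTop ℝ) ≤ ν₂.val f := by
    intro N
    induction N with
    | zero => exact fun f => (min_le_right _ _).trans (by simpa using ν₂.nonneg f)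
    | succ N ih =>
      intro f
      obtain ⟨q, r, hf, hr1, hr2⟩ := hdiv f
      obtain ⟨hfr, hfq⟩ := hkey f q r hf hr1
      have hq2 : min (ν₁.val f) ((N + 1 : ℕ) : WithTop ℝ) ≤ ν₂.val (q * Φ) := by
        rw [ν₂.val.map_mul]
        rw [ν₁.val.map_mul] at hfq
        rcases le_total (ν₁.val q) (N : WithTop ℝ) with h | h
        · have := ih q
          rw [min_eq_left h] at this
          exact (min_le_left _ _).trans (hfq.trans (add_le_add this hle))
        · have := ih q
          rw [min_eq_right h] at this
          refine (min_le_right _ _).trans ?_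
          rw [Nat.cast_succ]
          exact add_le_add this ((ν₁.one_le_val hΦm).trans hle)
      conv_rhs => rw [hf]
      refine ν₂.val.map_le_add hq2 ((min_le_left _ _).trans (hfr.trans ?_))
      rw [hr1, hr2]
  intro f
  change ν₁.val f ≤ ν₂.val f
  by_cases htop : ν₂.val f = ⊤
  · rw [htop]; exact le_top
  · obtain ⟨b, hb⟩ := WithTop.ne_top_iff_exists.1 htop
    obtain ⟨N, hNb⟩ := exists_nat_gt b
    refine (min_le_iff.1 (hN N f)).resolve_right fun h => ?_
    rw [← hb] at h
    exact absurd h (not_le.2 (by exact_mod_cast hNb))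

end Comparison

/-- If `ν₁` or `ν₂` is strictly smaller than `μ` somewhere, this happens at an element that is
not divisible by `x`, hence has finite order of vanishing modulo `x`. -/
theorem exists_notMem_span_of_val_lt {R : Type*} [CommRing R] [IsNoetherianRing R] [IsLocalRing R]
    {x z g : R} (hm : maximalIdeal R = Ideal.span {x, z}) {μ ν : ValuativeTree R}
    (hx : ν.val x = μ.val x) (hg : ν.val g < μ.val g) :
    ∃ (n : ℕ) (g' : R), g' ∉ Ideal.span {x, z ^ (n + 1)} ∧ ν.val g' < μ.val g' := by
  have hxm : x ∈ maximalIdeal R := hm ▸ Ideal.subset_span (by simp)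
  have hzm : z ∈ maximalIdeal R := hm ▸ Ideal.subset_span (by simp)
  have hne : ∀ {c : R}, c ∈ maximalIdeal R → Ideal.span {c} ≠ ⊤ := fun hc =>
    ne_top_of_le_ne_top (maximalIdeal.isMaximal R).ne_top
      ((Ideal.span_singleton_le_iff_mem _).2 hc)
  have hfin : FiniteMultiplicity x g := by
    by_contra hcon
    have : g ∈ (⊥ : Ideal R) := by
      refine Ideal.mem_of_forall_mem_sup_pow (hne hxm) fun n => ?_
      rw [bot_sup_eq, Ideal.span_singleton_pow, Ideal.mem_span_singleton]
      exact FiniteMultiplicity.not_iff_forall.1 hcon n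
    rw [Ideal.mem_bot] at this
    rw [this, AddValuation.map_zero, AddValuation.map_zero] at hg
    exact lt_irrefl _ hg
  obtain ⟨g', hgg', hndvd⟩ := hfin.exists_eq_pow_mul_and_not_dvd
  obtain ⟨n, hn⟩ : ∃ n : ℕ, g' ∉ Ideal.span {x} ⊔ Ideal.span {z} ^ n := by
    by_contra! hcon
    exact hndvd (Ideal.mem_span_singleton.1
      (Ideal.mem_of_forall_mem_sup_pow (hne hzm) hcon))
  refine ⟨n, g', fun hmem => hn ?_, ?_⟩
  · rw [Ideal.span_insert, ← Ideal.span_singleton_pow] at hmem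
    exact sup_le_sup (le_refl (Ideal.span {x})) (Ideal.pow_le_pow_right n.le_succ) hmem
  · rw [hgg', AddValuation.map_mul, AddValuation.map_mul, AddValuation.map_pow,
      AddValuation.map_pow, hx] at hg
    exact lt_of_add_lt_add_left hg

/-- Two valuations below a third one are comparable: the comparison is decided at an element of
least order of vanishing modulo `x` where one of them differs from `μ`. -/
theorem le_or_le_of_le {R : Type*} [CommRing R] [IsRegularLocalRing R]
    (hdim : ringKrullDim R = 2) {μ ν₁ ν₂ : ValuativeTree R} (h1 : ν₁ ≤ μ) (h2 : ν₂ ≤ μ) :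
    ν₁ ≤ ν₂ ∨ ν₂ ≤ ν₁ := by
  by_cases hle : ν₁ ≤ ν₂
  · exact Or.inl hle
  obtain ⟨x, hxm, hx⟩ := μ.normalized.1
  obtain ⟨z, hm⟩ := exists_maximalIdeal_eq_span_pair_of_notMem_sq hdim hxm (μ.notMem_sq hx)
  have hx1 : ν₁.val x = μ.val x := (val_eq_one_of_le h1 hxm hx).trans hx.symm
  have hx2 : ν₂.val x = μ.val x := (val_eq_one_of_le h2 hxm hx).trans hx.symm
  have hex : ∃ n : ℕ, ∃ g : R, g ∉ Ideal.span {x, z ^ (n + 1)} ∧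
      (ν₁.val g < μ.val g ∨ ν₂.val g < μ.val g) := by
    obtain ⟨g, hg⟩ : ∃ g, ν₂.val g < ν₁.val g := by
      by_contra! hcon
      exact hle hcon
    obtain ⟨n, g', hg', hlt⟩ := exists_notMem_span_of_val_lt hm hx2 (hg.trans_le (h1 g))
    exact ⟨n, g', hg', Or.inr hlt⟩
  classical
  obtain ⟨Φ, hΦ', hΦlt⟩ := Nat.find_spec hex
  have hmin := fun m => Nat.find_min hex (m := m)
  generalize Nat.find hex = d at hΦ' hmin
  have hagree : ∀ r ∉ Ideal.span {x, z ^ d}, ν₁.val r = μ.val r ∧ ν₂.val r = μ.val r := by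
    intro r hr
    cases d with
    | zero => exact absurd (Ideal.mem_span_pair.2 ⟨0, r, by simp⟩) hr
    | succ n =>
      by_contra hcon
      refine hmin n n.lt_succ_self ⟨r, hr, ?_⟩
      by_contra! hcon'
      exact hcon ⟨le_antisymm (h1 r) hcon'.1, le_antisymm (h2 r) hcon'.2⟩
  have hΦ : Φ ∈ Ideal.span {x, z ^ d} := by
    by_contra hcon
    obtain ⟨e1, e2⟩ := hagree Φ hcon
    rcases hΦlt with h | h
    · exact h.ne e1
    · exact h.ne e2
  have hΦm : Φ ∈ maximalIdeal R := by
    by_contra hcon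
    rw [notMem_maximalIdeal] at hcon
    simp [val_of_isUnit _ hcon] at hΦlt
  rcases le_total (ν₁.val Φ) (ν₂.val Φ) with h | h
  · refine Or.inl (le_of_val_le hm hΦm hΦ hΦ' h1 hx1 hx2 hagree ?_ h)
    exact hΦlt.elim id fun h' => h.trans_lt h'
  · refine Or.inr (le_of_val_le hm hΦm hΦ hΦ' h2 hx2 hx1
      (fun r hr => (hagree r hr).symm) ?_ h)
    exact hΦlt.elim (fun h' => h.trans_lt h') id

end ValuativeTree

/-! ### Curve valuations and the root -/

namespace ValuativeTree

/-- For a regular system of parameters `x, z` there is a curve valuation with `ν(x) = 1` and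
`ν(z) = ∞`: the order of vanishing on the quotient by a minimal prime over `z`, which is a discrete
valuation ring with uniformizer `x`. -/
theorem exists_curve_valuation {R : Type*} [CommRing R] [IsRegularLocalRing R]
    (hdim : ringKrullDim R = 2) {x z : R} (hm : maximalIdeal R = Ideal.span {x, z}) :
    ∃ ν : ValuativeTree R, ν.val x = 1 ∧ ν.val z = ⊤ := by
  have hxm : x ∈ maximalIdeal R := hm ▸ Ideal.subset_span (by simp)
  have hzm : z ∈ maximalIdeal R := hm ▸ Ideal.subset_span (by simp)
  obtain ⟨P, hP, hPm⟩ := Ideal.exists_minimalPrimes_le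
    ((Ideal.span_singleton_le_iff_mem (maximalIdeal R)).2 hzm)
  have hPprime : P.IsPrime := hP.1.1
  have hzP : z ∈ P := hP.1.2 (Ideal.mem_span_singleton_self z)
  have hxP : x ∉ P := by
    intro hxP
    have hPeq : P = maximalIdeal R := by
      refine le_antisymm hPm ?_
      rw [hm, Ideal.span_le]
      rintro c (rfl | rfl)
      exacts [hxP, hzP]
    have h1 : P.height ≤ 1 := Ideal.height_le_one_of_isPrincipal_of_mem_minimalPrimes _ P hP
    have h2 := IsLocalRing.maximalIdeal_height_eq_ringKrullDim (R := R)
    rw [hdim, ← hPeq] at h2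
    have h3 : P.height = 2 := WithBot.coe_injective h2
    rw [h3] at h1
    norm_num at h1
  let π := Ideal.Quotient.mk P
  have hπ : Function.Surjective π := Ideal.Quotient.mk_surjective
  have : IsLocalRing (R ⧸ P) := IsLocalRing.of_surjective' π hπ
  have : IsLocalHom π := IsLocalHom.of_surjective π hπ
  have hmax : maximalIdeal (R ⧸ P) = Ideal.span {π x} := by
    apply le_antisymm
    · intro a ha
      obtain ⟨b, rfl⟩ := hπ a
      have hb : b ∈ maximalIdeal R := by
        rw [mem_maximalIdeal] at ha ⊢
        exact fun hu => ha (hu.map π)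
      obtain ⟨u, v, huv⟩ := Ideal.mem_span_pair.1 (hm ▸ hb)
      refine Ideal.mem_span_singleton'.2 ⟨π u, ?_⟩
      rw [← huv, map_add, map_mul, map_mul, show π z = 0 from Ideal.Quotient.eq_zero_iff_mem.2 hzP,
        mul_zero, add_zero]
    · rw [Ideal.span_singleton_le_iff_mem, mem_maximalIdeal]
      exact fun hu => (mem_maximalIdeal x).1 hxm (isUnit_of_map_unit π x hu)
  have hx0 : π x ≠ 0 := fun h => hxP (Ideal.Quotient.eq_zero_iff_mem.1 h)
  have hprin : (maximalIdeal (R ⧸ P)).IsPrincipal := ⟨⟨π x, hmax⟩⟩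
  have hpir : IsPrincipalIdealRing (R ⧸ P) :=
    ((tfae_of_isNoetherianRing_of_isLocalRing_of_isDomain (R ⧸ P)).out 4 0).1 hprin
  have hdvr : IsDiscreteValuationRing (R ⧸ P) := by
    refine { not_a_field' := fun h => hx0 ?_ }
    have : π x ∈ maximalIdeal (R ⧸ P) := hmax ▸ Ideal.mem_span_singleton_self _
    rwa [h, Ideal.mem_bot] at this
  have hirr : Irreducible (π x) :=
    (IsDiscreteValuationRing.irreducible_iff_uniformizer _).2 hmax
  let e : ℕ∞ →+ WithTop ℝ := (Nat.castAddMonoidHom ℝ).ENatMap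
  have he : StrictMono e := WithTop.strictMono_map_iff.2 Nat.strictMono_cast
  have he1 : e 1 = 1 := congrArg WithTop.some (Nat.cast_one (R := ℝ))
  let v := (IsDiscreteValuationRing.addVal (R ⧸ P)).map e rfl he.monotone
  have hv : ∀ a, v a = e (IsDiscreteValuationRing.addVal (R ⧸ P) a) := fun _ => rfl
  have hvx : v.comap π x = 1 := by
    change v (π x) = 1
    rw [hv, IsDiscreteValuationRing.addVal_uniformizer hirr, he1]
  have hvm : ∀ φ ∈ maximalIdeal R, 1 ≤ v.comap π φ := by
    intro φ hφ
    change 1 ≤ v (π φ)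
    rw [hv, ← he1]
    refine he.monotone (Order.one_le_iff_pos.2 (pos_iff_ne_zero.2 fun h => ?_))
    rw [IsDiscreteValuationRing.addVal_eq_zero_iff] at h
    exact (mem_maximalIdeal φ).1 hφ (isUnit_of_map_unit π φ h)
  refine ⟨⟨v.comap π, fun φ => ?_, fun φ hφ => ?_, ⟨x, hxm, hvx⟩, ?_⟩, hvx, ?_⟩
  · change 0 ≤ e _
    rw [← map_zero e]
    exact he.monotone zero_le
  · exact zero_lt_one.trans_le (hvm φ hφ)
  · rintro _ ⟨φ, hφ, rfl⟩
    exact hvm φ hφ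
  · change v (π z) = ⊤
    rw [show π z = 0 from Ideal.Quotient.eq_zero_iff_mem.2 hzP, v.map_zero]

end ValuativeTree

/-- Elements of `(x, y) ^ n` are forms of degree `n` in `x` and `y`. -/
theorem Ideal.exists_sum_of_mem_span_pair_pow {R : Type*} [CommRing R] {x y : R} {n : ℕ} {φ : R}
    (h : φ ∈ Ideal.span {x, y} ^ n) :
    ∃ a : ℕ → R, φ = ∑ p ∈ Finset.HasAntidiagonal.antidiagonal n, a p.2 * (x ^ p.1 * y ^ p.2) := by
  induction n generalizing φ with
  | zero => exact ⟨fun _ => φ, by simp⟩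
  | succ n ih =>
    rw [pow_succ'] at h
    nth_rw 1 [Ideal.span_insert] at h
    rw [Ideal.sup_mul] at h
    obtain ⟨f, hf, g, hg, rfl⟩ := Submodule.mem_sup.1 h
    obtain ⟨u, hu, rfl⟩ := Ideal.mem_span_singleton_mul.1 hf
    obtain ⟨v, hv, rfl⟩ := Ideal.mem_span_singleton_mul.1 hg
    obtain ⟨a, rfl⟩ := ih hu
    obtain ⟨b, rfl⟩ := ih hv
    refine ⟨fun i => (if i = n + 1 then 0 else a i) + (if i = 0 then 0 else b (i - 1)), ?_⟩
    simp only [add_mul, Finset.sum_add_distrib]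
    rw [Finset.Nat.sum_antidiagonal_succ, Finset.Nat.sum_antidiagonal_succ']
    simp only [if_true, zero_mul, zero_add, Nat.succ_ne_zero, if_false, Nat.add_sub_cancel,
      Finset.mul_sum]
    congr 1
    · refine Finset.sum_congr rfl fun p hp => ?_
      have := Finset.HasAntidiagonal.mem_antidiagonal.1 hp
      rw [if_neg (by omega)]
      ring
    · exact Finset.sum_congr rfl fun p _ => by ring

namespace ValuativeTree

/-- Along the pencil `y - t x` of smooth curves, all but finitely many curve valuations of `φ`
equal the multiplicity `n` of `φ`: modulo `y - t x`, the initial form of `φ` becomes `x ^ n` times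
a polynomial in `t`, which vanishes at finitely many residue classes only. -/
theorem exists_eventually_val_eq {R : Type*} [CommRing R] [IsNoetherianRing R] [IsLocalRing R]
    {x y : R} (hm : maximalIdeal R = Ideal.span {x, y}) {t : ResidueField R → R}
    (ht : ∀ θ, residue R (t θ) = θ) {C : ResidueField R → ValuativeTree R}
    (hCx : ∀ θ, (C θ).val x = 1) (hCy : ∀ θ, (C θ).val (y - t θ * x) = ⊤) (φ : R) :
    ∃ c : WithTop ℝ, (∀ᶠ θ in cofinite, (C θ).val φ = c) ∧
      ∀ ν : ValuativeTree R, c ≤ ν.val φ := by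
  by_cases hφ : φ = 0
  · subst hφ
    exact ⟨⊤, by simp, by simp⟩
  obtain ⟨n, hn, hn'⟩ : ∃ n : ℕ, φ ∈ maximalIdeal R ^ n ∧ φ ∉ maximalIdeal R ^ (n + 1) := by
    by_contra! hcon
    have hall : ∀ n : ℕ, φ ∈ maximalIdeal R ^ n := fun n => by
      induction n with
      | zero => simp
      | succ n ih => exact hcon n ih
    have := Ideal.mem_of_forall_mem_sup_pow (J := ⊥) (maximalIdeal.isMaximal R).ne_top
      fun n => by rw [bot_sup_eq]; exact hall n
    exact hφ (Ideal.mem_bot.1 this)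
  refine ⟨n, ?_, fun ν => ν.natCast_le_val hn⟩
  obtain ⟨a, ha⟩ := Ideal.exists_sum_of_mem_span_pair_pow (hm ▸ hn)
  have hxm : x ∈ maximalIdeal R := hm ▸ Ideal.subset_span (by simp)
  have hym : y ∈ maximalIdeal R := hm ▸ Ideal.subset_span (by simp)
  let p : Polynomial (ResidueField R) :=
    ∑ i ∈ Finset.range (n + 1), Polynomial.monomial i (residue R (a i))
  have hcoeff : ∀ i ≤ n, p.coeff i = residue R (a i) := by
    intro i hi
    simp [p, Polynomial.finsetSum_coeff, Polynomial.coeff_monomial, Nat.lt_succ_of_le hi]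
  have hp : p ≠ 0 := by
    intro hp
    refine hn' ?_
    rw [ha]
    refine Ideal.sum_mem _ fun q hq => ?_
    have hq' := Finset.HasAntidiagonal.mem_antidiagonal.1 hq
    rw [pow_succ']
    refine Ideal.mul_mem_mul ?_ ?_
    · rw [← residue_eq_zero_iff, ← hcoeff q.2 (by omega), hp, Polynomial.coeff_zero]
    · rw [← hq', pow_add]
      exact Ideal.mul_mem_mul (Ideal.pow_mem_pow hxm _) (Ideal.pow_mem_pow hym _)
  have hfin : {θ | p.IsRoot θ}.Finite := Polynomial.finite_setOfPred_isRoot hp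
  filter_upwards [hfin.compl_mem_cofinite] with θ hθ
  let s := ∑ q ∈ Finset.HasAntidiagonal.antidiagonal n, a q.2 * t θ ^ q.2
  have hs : IsUnit s := by
    rw [← notMem_maximalIdeal, ← residue_eq_zero_iff]
    intro h0
    refine hθ ?_
    change p.eval θ = 0
    rw [← h0]
    simp only [s, p, Polynomial.eval_finsetSum, Polynomial.eval_monomial, map_sum, map_mul,
      map_pow, ht]
    rw [← Finset.sum_flip, Finset.Nat.sum_antidiagonal_eq_sum_range_succ_mk]
  have hdvd : y - t θ * x ∣ φ - x ^ n * s := by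
    rw [ha, Finset.mul_sum, ← Finset.sum_sub_distrib]
    refine Finset.dvd_sum fun q hq => ?_
    obtain ⟨w, hw⟩ := sub_dvd_pow_sub_pow y (t θ * x) q.2
    refine ⟨a q.2 * x ^ q.1 * w, ?_⟩
    rw [← Finset.HasAntidiagonal.mem_antidiagonal.1 hq]
    linear_combination (a q.2 * x ^ q.1) * hw
  obtain ⟨w, hw⟩ := hdvd
  rw [(C θ).val_congr (b := x ^ n * s) (by rw [hw, AddValuation.map_mul, hCy, top_add]),
    AddValuation.map_mul, AddValuation.map_pow, hCx, val_of_isUnit _ hs, add_zero, nsmul_one]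

/-- The multiplicity valuation is the generic value along a pencil of smooth curves, and it is the
smallest element of the valuative tree. -/
theorem exists_isBot {R : Type*} [CommRing R] [IsNoetherianRing R] [IsLocalRing R]
    [Infinite (ResidueField R)]
    {x y : R} (hm : maximalIdeal R = Ideal.span {x, y}) {t : ResidueField R → R}
    (ht : ∀ θ, residue R (t θ) = θ) {C : ResidueField R → ValuativeTree R}
    (hCx : ∀ θ, (C θ).val x = 1) (hCy : ∀ θ, (C θ).val (y - t θ * x) = ⊤) :
    ∃ r : ValuativeTree R, IsBot r := by
  choose c hc hcle using exists_eventually_val_eq hm ht hCx hCy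
  have hle : ∀ φ, (∀ ν : ValuativeTree R, 1 ≤ ν.val φ) → 1 ≤ c φ := fun φ h => by
    obtain ⟨θ, hθ⟩ := (hc φ).exists
    exact hθ ▸ h _
  have hxm : x ∈ maximalIdeal R := hm ▸ Ideal.subset_span (by simp)
  refine ⟨⟨AddValuation.of c ?_ ?_ ?_ ?_, fun φ => ?_, fun φ hφ => ?_, ⟨x, hxm, ?_⟩, ?_⟩,
    fun ν φ => hcle φ ν⟩
  · obtain ⟨θ, hθ⟩ := (hc 0).exists
    rw [← hθ, AddValuation.map_zero]
  · obtain ⟨θ, hθ⟩ := (hc 1).exists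
    rw [← hθ, AddValuation.map_one]
  · intro a b
    obtain ⟨θ, h1, h2, h3⟩ := ((hc a).and ((hc b).and (hc (a + b)))).exists
    rw [← h1, ← h2, ← h3]
    exact (C θ).val.map_add a b
  · intro a b
    obtain ⟨θ, h1, h2, h3⟩ := ((hc a).and ((hc b).and (hc (a * b)))).exists
    rw [← h1, ← h2, ← h3]
    exact (C θ).val.map_mul a b
  · obtain ⟨θ, hθ⟩ := (hc φ).exists
    exact ((C θ).nonneg φ).trans_eq hθ
  · exact zero_lt_one.trans_le (hle φ fun ν => ν.one_le_val hφ)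
  · obtain ⟨θ, hθ⟩ := (hc x).exists
    exact hθ.symm.trans (hCx θ)
  · rintro _ ⟨φ, hφ, rfl⟩
    exact hle φ fun ν => ν.one_le_val hφ

/-- A common lower bound of two curve valuations with different tangent directions is the
smallest element. -/
theorem eq_bot_of_le_curves {R : Type*} [CommRing R] [IsNoetherianRing R] [IsLocalRing R]
    {x y : R} (hm : maximalIdeal R = Ideal.span {x, y}) {t t' : R} (htt : IsUnit (t - t'))
    {r ν C C' : ValuativeTree R} (hr : IsBot r) (hCx : C.val x = 1)
    (hCy : C.val (y - t * x) = ⊤) (hCx' : C'.val x = 1) (hCy' : C'.val (y - t' * x) = ⊤)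
    (h : ν ≤ C) (h' : ν ≤ C') : ν = r := by
  have hxm : x ∈ maximalIdeal R := hm ▸ Ideal.subset_span (by simp)
  have hym : y ∈ maximalIdeal R := hm ▸ Ideal.subset_span (by simp)
  have key : ∀ (t : R) (C : ValuativeTree R), C.val x = 1 → C.val (y - t * x) = ⊤ → ν ≤ C →
      ν ≠ r → 1 < ν.val (y - t * x) := by
    intro t C hCx hCy h hne
    by_contra! hcon
    have hzm : y - t * x ∈ maximalIdeal R :=
      Ideal.sub_mem _ hym (Ideal.mul_mem_left _ _ hxm)
    have hmz : maximalIdeal R = Ideal.span {x, y - t * x} := by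
      apply le_antisymm
      · rw [hm, Ideal.span_le]
        rintro c (rfl | rfl)
        · exact Ideal.subset_span (by simp)
        · exact Ideal.mem_span_pair.2 ⟨t, 1, by ring⟩
      · rw [Ideal.span_le]
        rintro c (rfl | rfl)
        exacts [hxm, hzm]
    have hz1 : ν.val (y - t * x) = 1 := le_antisymm hcon (ν.one_le_val hzm)
    have hrx : r.val x = 1 := val_eq_one_of_le (hr C) hxm hCx
    refine hne (le_antisymm ?_ (hr ν))
    refine le_of_val_le (d := 1) hmz hzm (Ideal.subset_span (by simp)) (fun hmem => ?_) h
      ((val_eq_one_of_le h hxm hCx).trans hCx.symm) (hrx.trans hCx.symm) (fun a ha => ?_) ?_ ?_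
    · -- Otherwise `y - t x` would lie in the square of the maximal ideal.
      obtain ⟨b, c, hbc⟩ := Ideal.mem_span_pair.1 hmem
      have hb : b ∈ maximalIdeal R := by
        by_contra hb
        have h0 : C.val ((y - t * x) - c * (y - t * x) ^ 2) = C.val (b * x) :=
          congrArg _ (by linear_combination -hbc)
        rw [show (y - t * x) - c * (y - t * x) ^ 2 = (1 - c * (y - t * x)) * (y - t * x) by ring,
          AddValuation.map_mul, AddValuation.map_mul, hCy, hCx, add_top,
          val_of_isUnit _ (notMem_maximalIdeal.1 hb), zero_add] at h0
        exact WithTop.top_ne_one h0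
      refine ν.notMem_sq hz1 ?_
      rw [pow_two, ← hbc]
      refine Ideal.add_mem _ (Ideal.mul_mem_mul hb hxm) (Ideal.mul_mem_left _ _ ?_)
      rw [one_add_one_eq_two, pow_two]
      exact Ideal.mul_mem_mul hzm hzm
    · rw [pow_one, ← hmz, notMem_maximalIdeal] at ha
      simp [val_of_isUnit _ ha]
    · rw [hz1, hCy]
      exact WithTop.one_lt_top
    · rw [hz1]
      exact r.one_le_val hzm
  by_contra hne
  have h1 := key t C hCx hCy h hne
  have h2 := key t' C' hCx' hCy' h' hne
  have h3 : 1 < ν.val ((y - t' * x) - (y - t * x)) := by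
    rw [sub_eq_add_neg]
    exact ν.val.map_lt_add h2 (by rwa [ν.val.map_neg])
  rw [show (y - t' * x) - (y - t * x) = (t - t') * x by ring, ν.val.map_mul,
    val_of_isUnit _ htt, zero_add, val_eq_one_of_le h hxm hCx] at h3
  exact lt_irrefl _ h3

end ValuativeTree

/-! ### Infima -/

namespace ValuativeTree

/-- The pointwise supremum of a nonempty chain of valuations lying below a given one is again a
valuation of the tree. -/
theorem exists_isLUB_of_isChain {R : Type*} [CommRing R] [IsLocalRing R]
    {L : Set (ValuativeTree R)} (hL : IsChain (· ≤ ·) L) (hne : L.Nonempty)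
    {τ : ValuativeTree R} (hτ : ∀ ν ∈ L, ν ≤ τ) : ∃ m : ValuativeTree R, IsLUB L m := by
  let M : R → WithTop ℝ := fun φ => sSup ((fun ν : ValuativeTree R => ν.val φ) '' L)
  have hM : ∀ φ, IsLUB ((fun ν : ValuativeTree R => ν.val φ) '' L) (M φ) := fun φ =>
    WithTop.isLUB_sSup' (hne.image _)
  have hle : ∀ ν ∈ L, ∀ φ, ν.val φ ≤ M φ := fun ν hν φ => (hM φ).1 ⟨ν, hν, rfl⟩
  have hMle : ∀ φ b, (∀ ν ∈ L, ν.val φ ≤ b) → M φ ≤ b := fun φ b h =>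
    (hM φ).2 (by rintro _ ⟨ν, hν, rfl⟩; exact h ν hν)
  obtain ⟨ν₀, hν₀⟩ := hne
  have hconst : ∀ φ c, (∀ ν ∈ L, ν.val φ = c) → M φ = c := fun φ c h =>
    le_antisymm (hMle φ c fun ν hν => (h ν hν).le) (h ν₀ hν₀ ▸ hle ν₀ hν₀ φ)
  obtain ⟨x, hxm, hx⟩ := τ.normalized.1
  have hpair : ∀ ν ∈ L, ∀ ν' ∈ L, ∃ ω ∈ L, ν ≤ ω ∧ ν' ≤ ω := fun ν hν ν' hν' =>
    (hL.total hν hν').elim (fun h => ⟨ν', hν', h, le_rfl⟩) fun h => ⟨ν, hν, le_rfl, h⟩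
  have hmul : ∀ a b, M (a * b) = M a + M b := by
    intro a b
    refine le_antisymm (hMle _ _ fun ν hν => ?_) ?_
    · rw [ν.val.map_mul]
      exact add_le_add (hle ν hν a) (hle ν hν b)
    -- Both suprema may be taken separately because `L` is directed.
    have hsum : ∀ ν ∈ L, ∀ ν' ∈ L, ν.val a + ν'.val b ≤ M (a * b) := by
      intro ν hν ν' hν'
      obtain ⟨ω, hω, h, h'⟩ := hpair ν hν ν' hν'
      refine (add_le_add (h a) (h' b)).trans ?_
      rw [← ω.val.map_mul]
      exact hle ω hω _
    by_cases htop : M (a * b) = ⊤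
    · rw [htop]; exact le_top
    obtain ⟨c, hc⟩ := WithTop.ne_top_iff_exists.1 htop
    rw [← hc] at hsum ⊢
    have hsub : ∀ u w : WithTop ℝ, 0 ≤ u → 0 ≤ w → u + w ≤ c →
        ∃ r s : ℝ, u = r ∧ w = s ∧ r + s ≤ c := by
      intro u w hu hw h
      induction u with
      | top => simp at h
      | coe r =>
        induction w with
        | top => simp at h
        | coe s => exact ⟨r, s, rfl, rfl, by exact_mod_cast h⟩
    have hb : ∀ ν ∈ L, ν.val a + M b ≤ c := by
      intro ν hν
      obtain ⟨r, -, hr, -, -⟩ := hsub _ _ (ν.nonneg a) (ν₀.nonneg b) (hsum ν hν ν₀ hν₀)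
      have : M b ≤ ((c - r : ℝ) : WithTop ℝ) := hMle b _ fun ν' hν' => by
        obtain ⟨r', s, hr', hs, hrs⟩ := hsub _ _ (ν.nonneg a) (ν'.nonneg b) (hsum ν hν ν' hν')
        rw [hs]
        have : r = r' := WithTop.coe_injective (hr.symm.trans hr')
        exact_mod_cast (by linarith : s ≤ c - r)
      rw [hr]
      refine (add_le_add le_rfl this).trans ?_
      exact_mod_cast (by linarith : r + (c - r) ≤ c)
    have hMb : 0 ≤ M b := (ν₀.nonneg b).trans (hle ν₀ hν₀ b)
    obtain ⟨-, s, -, hs, -⟩ := hsub _ _ (ν₀.nonneg a) hMb (hb ν₀ hν₀)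
    have : M a ≤ ((c - s : ℝ) : WithTop ℝ) := hMle a _ fun ν hν => by
      obtain ⟨r, s', hr, hs', hrs⟩ := hsub _ _ (ν.nonneg a) hMb (hb ν hν)
      rw [hr]
      have : s = s' := WithTop.coe_injective (hs.symm.trans hs')
      exact_mod_cast (by linarith : r ≤ c - s)
    rw [hs]
    refine (add_le_add this le_rfl).trans ?_
    exact_mod_cast (by linarith : c - s + s ≤ c)
  have hadd : ∀ a b, min (M a) (M b) ≤ M (a + b) := by
    intro a b
    by_contra! hcon
    obtain ⟨_, ⟨ν, hν, rfl⟩, h⟩ := (lt_isLUB_iff (hM a)).1 (lt_min_iff.1 hcon).1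
    obtain ⟨_, ⟨ν', hν', rfl⟩, h'⟩ := (lt_isLUB_iff (hM b)).1 (lt_min_iff.1 hcon).2
    obtain ⟨ω, hω, hνω, hνω'⟩ := hpair ν hν ν' hν'
    exact (ω.val.map_lt_add (h.trans_le (hνω a)) (h'.trans_le (hνω' b))).not_ge (hle ω hω _)
  refine ⟨⟨AddValuation.of M (hconst 0 ⊤ fun ν _ => ν.val.map_zero)
    (hconst 1 0 fun ν _ => ν.val.map_one) hadd hmul, fun φ => ?_, fun φ hφ => ?_,
    ⟨x, hxm, ?_⟩, ?_⟩, fun ν hν φ => hle ν hν φ, fun ω hω φ => hMle φ _ fun ν hν => hω hν φ⟩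
  · exact (ν₀.nonneg φ).trans (hle ν₀ hν₀ φ)
  · exact (ν₀.pos φ hφ).trans_le (hle ν₀ hν₀ φ)
  · exact hconst x 1 fun ν hν => val_eq_one_of_le (hτ ν hν) hxm hx
  · rintro _ ⟨φ, hφ, rfl⟩
    exact (ν₀.one_le_val hφ).trans (hle ν₀ hν₀ φ)

/-- Infima exist: the lower bounds of a nonempty set form a chain, whose supremum is the
infimum. -/
theorem exists_isGLB {R : Type*} [CommRing R] [IsRegularLocalRing R]
    (hdim : ringKrullDim R = 2) {r : ValuativeTree R} (hr : IsBot r)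
    {S : Set (ValuativeTree R)} (hS : S.Nonempty) : ∃ m : ValuativeTree R, IsGLB S m := by
  obtain ⟨τ, hτ⟩ := hS
  obtain ⟨m, hm⟩ := exists_isLUB_of_isChain (L := lowerBounds S)
    (fun a ha b hb _ => le_or_le_of_le hdim (ha hτ) (hb hτ)) ⟨r, fun σ _ => hr σ⟩
    (fun ν hν => hν hτ)
  exact ⟨m, isLUB_lowerBounds.1 hm⟩

end ValuativeTree

/-! ### The valuative tree and its topologies -/

/-- Let `R` be a two-dimensional regular local ring with uncountable residue field and `Ψ` a
parametrization of its valuative tree with values in `[1, ∞]`. Then the valuative tree is a rooted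
non-metric tree, `d_Ψ` is a metric on it, and the weak tree topology is strictly coarser than the
topology of this metric (in Mathlib's order on topologies, finer ones are smaller). -/
theorem mainTheorem5 (R : Type*) [CommRing R] [IsRegularLocalRing R]
    (hdim : ringKrullDim R = 2) (hres : Uncountable (IsLocalRing.ResidueField R))
    (Ψ : ValuativeTree R → EReal) (hΨ : NonMetricTree.IsIncreasingParametrization Ψ)
    (hΨ1 : ∀ ν, 1 ≤ Ψ ν) :
    NonMetricTree.IsRootedNonMetricTree (ValuativeTree R) ∧
      ∃ M : MetricSpace (ValuativeTree R),
        (∀ ν μ, M.dist ν μ = NonMetricTree.paramDist Ψ ν μ) ∧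
        M.toUniformSpace.toTopologicalSpace <
          NonMetricTree.weakTreeTopology (ValuativeTree R) := by
  obtain ⟨x, y, hm⟩ := exists_maximalIdeal_eq_span_pair hdim
  choose t ht using residue_surjective (R := R)
  have hcurve : ∀ θ, ∃ C : ValuativeTree R, C.val x = 1 ∧ C.val (y - t θ * x) = ⊤ := fun θ =>
    ValuativeTree.exists_curve_valuation hdim <| by
      rw [hm, sub_eq_add_neg, ← neg_mul, Ideal.span_pair_add_mul_left]
  choose C hCx hCy using hcurve
  obtain ⟨r, hr⟩ := ValuativeTree.exists_isBot hm ht hCx hCy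
  have hcomp : ∀ {τ a b : ValuativeTree R}, a ≤ τ → b ≤ τ → a ≤ b ∨ b ≤ a :=
    ValuativeTree.le_or_le_of_le hdim
  have hinf : ∀ S : Set (ValuativeTree R), S.Nonempty → ∃ m, IsGLB S m := fun _ =>
    ValuativeTree.exists_isGLB hdim hr
  have hT : NonMetricTree.IsMeetTree (ValuativeTree R) := ⟨hcomp, fun a b => hinf _ ⟨a, by simp⟩⟩
  have hunit : ∀ {θ θ'}, θ ≠ θ' → IsUnit (t θ - t θ') := fun hne => by
    rw [← notMem_maximalIdeal, ← residue_eq_zero_iff, map_sub, ht, ht]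
    exact sub_ne_zero.2 hne
  have hbranch : ∀ θ θ' τ, τ ≤ C θ → τ ≤ C θ' → θ ≠ θ' → τ = r := by
    intro θ θ' τ h h' hne
    exact ValuativeTree.eq_bot_of_le_curves hm (hunit hne) hr (hCx θ) (hCy θ) (hCx θ') (hCy θ')
      h h'
  -- If `C θ` were the root it would lie below another curve valuation `C θ'`, which takes the
  -- value `1`, not `∞`, at `y - t θ x`.
  have hCr : ∀ θ, C θ ≠ r := by
    intro θ hθ
    obtain ⟨θ', hne⟩ := exists_ne θ
    have hle : C θ ≤ C θ' := hθ ▸ hr (C θ')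
    have h1 : (C θ').val (y - t θ * x) = ⊤ := top_le_iff.1 (hCy θ ▸ hle (y - t θ * x))
    have h2 := (C θ').val.map_sub (y - t θ' * x) (y - t θ * x)
    rw [h1, hCy, min_self, top_le_iff,
      show (y - t θ' * x) - (y - t θ * x) = (t θ - t θ') * x by ring, AddValuation.map_mul,
      ValuativeTree.val_of_isUnit _ (hunit hne.symm), zero_add, hCx] at h2
    exact WithTop.one_ne_top h2
  refine ⟨⟨⟨r, hr⟩, fun τ => ?_, NonMetricTree.exists_interval_of_parametrization hΨ hΨ1, hinf⟩,
    NonMetricTree.treeMetric hT (NonMetricTree.strictAnti_inv_parametrization hΨ hΨ1),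
    fun _ _ => rfl, NonMetricTree.treeMetric_lt_weakTreeTopology hT _ hr C hCr hbranch⟩
  exact NonMetricTree.exists_interval_of_parametrization hΨ hΨ1 (Set.Iic τ)
    (fun a ha b hb _ => hcomp ha hb) Set.ordConnected_Iic
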